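/- Let $X\neq\{0\}$ be a complex Banach space and let $\mathcal U=\{U(t,s)\}_{t\ge s\ge 0}$ be an evolution family of bounded linear operators on $X$: $U(t,t)=\mathrm{Id}$ for $t\ge0$, $U(t,\tau)U(\tau,s)=U(t,s)$ for $t\ge\tau\ge s\ge0$, and $(t,s)\mapsto U(t,s)x$ is continuous on $\{t\ge s\ge 0\}$ for each $x\in X$. A number $\alpha\in\mathbb R$ is an admissible exponent of $\mathcal U$ if there is a continuous map $M_\alpha:\mathbb R_+\to(0,\infty)$ with $\|U(t,s)\|\le M_\alpha(s)e^{\alpha(t-s)}$ for all $t\ge s\ge0$. For such $\alpha$ and for $u\in C(\mathbb R_+,X)$ put $$\varphi_{\mathcal U,\alpha}(t,u)=\sup_{\tau\ge t}e^{-\alpha(\tau-t)}\|U(\tau,t)u(t)\|,\qquad t\ge 0,$$ and let $\mathcal C(\mathcal U,\alpha)$ be the Banach space of all $u\in C(\mathbb R_+,X)$ with $\lim_{t\to\infty}\varphi_{\mathcal U,\alpha}(t,u)=\varphi_{\mathcal U,\alpha}(0,u)=0$, with the norm $\|u\|_{\mathcal U,\alpha}=\sup_{t\ge0}\varphi_{\mathcal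 U,\alpha}(t,u)$. The nonuniform evolution semigroup $\{T_\alpha(t)\}_{t\ge0}$ on $\mathcal C(\mathcal U,\alpha)$ is given by $$(T_\alpha(t)u)(s)=\begin{cases}U(s,s-t)u(s-t),& s>t,\\ 0,& 0\le s\le t,\end{cases}$$ and $G_{\mathcal U,\alpha}$ denotes its infinitesimal generator. **Corollary (The Spectral Mapping Theorem).** Let $\alpha$ be an admissible exponent of $\mathcal U$. Then $$e^{t\sigma(G_{\mathcal U,\alpha})}=\sigma(T_\alpha(t))\setminus\{0\}\qquad\text{for all } t>0,$$ and the identity holds for $t=0$ too if $\sigma(G_{\mathcal U,\alpha})\neq\emptyset$. Moreover, $\sigma(G_{\mathcal U,\alpha})$ is a closed left half-plane $\{\lambda\in\mathbb C:\operatorname{Re}\lambda\le\omega\}$ with $\omega\in[-\infty,\infty)$ (the empty set if $\omega=-\infty$), and for every $t\ge0$ the spectrum $\sigma(T_\alpha(t))$ is a closed disc of radius $r\geq 0$ (possibly a single point), centred at $0$ if $t>0$. -/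

import Mathlib

open Filter Topology
open scoped NNReal

noncomputable section

/-! ### Evolution families -/

/-- An evolution family `{U(t,s)}_{t ≥ s ≥ 0}` of bounded linear operators on `X`. The values
`U t s` with `t < s` are irrelevant: no law constrains them and no definition below uses them. -/
structure EvolutionFamily (X : Type*) [NormedAddCommGroup X] [NormedSpace ℂ X] where
  /-- the operators `U(t,s)` -/
  op : ℝ≥0 → ℝ≥0 → X →L[ℂ] X
  op_self : ∀ t, op t t = ContinuousLinearMap.id ℂ X
  op_comp : ∀ t τ s, s ≤ τ → τ ≤ t → (op t τ).comp (op τ s) = op t s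
  continuousOn_op : ∀ x : X, ContinuousOn (fun p : ℝ≥0 × ℝ≥0 => op p.1 p.2 x) {p | p.2 ≤ p.1}

namespace EvolutionFamily

variable {X : Type*} [NormedAddCommGroup X] [NormedSpace ℂ X]

/-- `α` is an admissible exponent of `U`: `‖U(t,s)‖ ≤ M(s) e^{α(t-s)}` for all `t ≥ s ≥ 0`, for
some continuous `M : ℝ₊ → (0,∞)`. -/
def IsAdmissible (U : EvolutionFamily X) (α : ℝ) : Prop :=
  ∃ M : ℝ≥0 → ℝ, Continuous M ∧ (∀ s, 0 < M s) ∧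
    ∀ s t : ℝ≥0, s ≤ t → ‖U.op t s‖ ≤ M s * Real.exp (α * ((t : ℝ) - s))

/-- `φ_{U,α}(t,u) = sup_{τ ≥ t} e^{-α(τ-t)} ‖U(τ,t) u(t)‖`. -/
def varphi (U : EvolutionFamily X) (α : ℝ) (t : ℝ≥0) (u : C(ℝ≥0, X)) : ℝ :=
  ⨆ τ : Set.Ici t, Real.exp (-α * ((τ : ℝ≥0) - (t : ℝ))) * ‖U.op τ t (u t)‖

variable {U : EvolutionFamily X} {α : ℝ}

lemma term_le {M : ℝ≥0 → ℝ}
    (hM : ∀ s t : ℝ≥0, s ≤ t → ‖U.op t s‖ ≤ M s * Real.exp (α * ((t : ℝ) - s)))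
    (t : ℝ≥0) (x : X) (τ : ℝ≥0) (hτ : t ≤ τ) :
    Real.exp (-α * ((τ : ℝ) - t)) * ‖U.op τ t x‖ ≤ M t * ‖x‖ := by
  have h1 : ‖U.op τ t x‖ ≤ M t * Real.exp (α * ((τ : ℝ) - t)) * ‖x‖ :=
    ((U.op τ t).le_opNorm x).trans (mul_le_mul_of_nonneg_right (hM t τ hτ) (norm_nonneg _))
  calc Real.exp (-α * ((τ : ℝ) - t)) * ‖U.op τ t x‖
      ≤ Real.exp (-α * ((τ : ℝ) - t)) * (M t * Real.exp (α * ((τ : ℝ) - t)) * ‖x‖) :=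
        mul_le_mul_of_nonneg_left h1 (Real.exp_pos _).le
    _ = (Real.exp (-α * ((τ : ℝ) - t)) * Real.exp (α * ((τ : ℝ) - t))) * (M t * ‖x‖) := by ring
    _ = M t * ‖x‖ := by
        rw [← Real.exp_add, neg_mul, neg_add_cancel, Real.exp_zero, one_mul]

lemma bddAbove_terms (h : U.IsAdmissible α) (t : ℝ≥0) (x : X) :
    BddAbove (Set.range fun τ : Set.Ici t =>
      Real.exp (-α * ((τ : ℝ≥0) - (t : ℝ))) * ‖U.op τ t x‖) := by
  obtain ⟨M, -, -, hM⟩ := h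
  refine ⟨M t * ‖x‖, ?_⟩
  rintro _ ⟨⟨τ, hτ⟩, rfl⟩
  exact term_le hM t x τ hτ

instance (t : ℝ≥0) : Nonempty (Set.Ici t) := ⟨⟨t, Set.self_mem_Ici⟩⟩

lemma varphi_nonneg (t : ℝ≥0) (u : C(ℝ≥0, X)) : 0 ≤ U.varphi α t u :=
  Real.iSup_nonneg fun _ => mul_nonneg (Real.exp_pos _).le (norm_nonneg _)

lemma norm_le_varphi (h : U.IsAdmissible α) (t : ℝ≥0) (u : C(ℝ≥0, X)) :
    ‖u t‖ ≤ U.varphi α t u := by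
  have := le_ciSup (bddAbove_terms h t (u t)) ⟨t, Set.self_mem_Ici⟩
  simpa [U.op_self, varphi] using this

lemma varphi_le {M : ℝ≥0 → ℝ}
    (hM : ∀ s t : ℝ≥0, s ≤ t → ‖U.op t s‖ ≤ M s * Real.exp (α * ((t : ℝ) - s)))
    (t : ℝ≥0) (u : C(ℝ≥0, X)) : U.varphi α t u ≤ M t * ‖u t‖ :=
  ciSup_le fun τ => term_le hM t (u t) τ τ.2

lemma varphi_add_le (h : U.IsAdmissible α) (t : ℝ≥0) (u v : C(ℝ≥0, X)) :
    U.varphi α t (u + v) ≤ U.varphi α t u + U.varphi α t v := by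
  refine ciSup_le fun τ => ?_
  have h1 := le_ciSup (bddAbove_terms h t (u t)) τ
  have h2 := le_ciSup (bddAbove_terms h t (v t)) τ
  have h3 : ‖U.op τ t ((u + v) t)‖ ≤ ‖U.op τ t (u t)‖ + ‖U.op τ t (v t)‖ := by
    rw [ContinuousMap.add_apply, map_add]; exact norm_add_le _ _
  calc _ ≤ Real.exp (-α * ((τ : ℝ≥0) - (t : ℝ))) * (‖U.op τ t (u t)‖ + ‖U.op τ t (v t)‖) :=
        mul_le_mul_of_nonneg_left h3 (Real.exp_pos _).le
    _ ≤ _ := by rw [mul_add]; exact add_le_add h1 h2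

lemma varphi_smul (t : ℝ≥0) (c : ℂ) (u : C(ℝ≥0, X)) :
    U.varphi α t (c • u) = ‖c‖ * U.varphi α t u := by
  unfold varphi
  rw [Real.mul_iSup_of_nonneg (norm_nonneg c)]
  congr 1
  ext τ
  rw [ContinuousMap.smul_apply, map_smul, norm_smul]
  ring

lemma varphi_eq_zero (t : ℝ≥0) (u : C(ℝ≥0, X)) (hu : u t = 0) : U.varphi α t u = 0 := by
  simp [varphi, hu]

/-- The set underlying `𝒞(U,α)`: the continuous `u : ℝ₊ → X` such that
`lim_{t → ∞} φ_{U,α}(t,u) = φ_{U,α}(0,u) = 0`. -/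
def admissibleSubmodule (U : EvolutionFamily X) (α : ℝ) (h : U.IsAdmissible α) :
    Submodule ℂ C(ℝ≥0, X) where
  carrier := {u | Tendsto (fun t => U.varphi α t u) atTop (𝓝 0) ∧ U.varphi α 0 u = 0}
  zero_mem' := by
    have h0 : ∀ t, U.varphi α t (0 : C(ℝ≥0, X)) = 0 := fun t => varphi_eq_zero t 0 rfl
    simp [h0]
  add_mem' := by
    rintro u v ⟨hu, hu0⟩ ⟨hv, hv0⟩
    refine ⟨squeeze_zero (fun t => varphi_nonneg t _) (fun t => varphi_add_le h t u v) ?_, ?_⟩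
    · simpa using hu.add hv
    · exact le_antisymm ((varphi_add_le h 0 u v).trans (by simp [hu0, hv0])) (varphi_nonneg _ _)
  smul_mem' := by
    rintro c u ⟨hu, hu0⟩
    refine ⟨?_, ?_⟩
    · simpa [varphi_smul] using hu.const_mul ‖c‖
    · simp [varphi_smul, hu0]

/-- The admissible Banach function space `𝒞(U,α)`. It is a type of its own because its topology is
the one of the norm below, not the one induced from `C(ℝ₊, X)`. -/
def AdmissibleSpace (U : EvolutionFamily X) (α : ℝ) (h : U.IsAdmissible α) : Type _ :=
  U.admissibleSubmodule α h

variable {h : U.IsAdmissible α}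

instance : AddCommGroup (U.AdmissibleSpace α h) :=
  inferInstanceAs (AddCommGroup (U.admissibleSubmodule α h))

instance : Module ℂ (U.AdmissibleSpace α h) :=
  inferInstanceAs (Module ℂ (U.admissibleSubmodule α h))

namespace AdmissibleSpace

/-- The continuous function underlying an element of `𝒞(U,α)`. -/
def toFn (u : U.AdmissibleSpace α h) : C(ℝ≥0, X) := Subtype.val u

@[ext] lemma ext {u v : U.AdmissibleSpace α h} (H : ∀ s, u.toFn s = v.toFn s) : u = v :=
  Subtype.ext (ContinuousMap.ext H)

@[simp] lemma toFn_add (u v : U.AdmissibleSpace α h) : (u + v).toFn = u.toFn + v.toFn := rfl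
@[simp] lemma toFn_smul (c : ℂ) (u : U.AdmissibleSpace α h) : (c • u).toFn = c • u.toFn := rfl
@[simp] lemma toFn_zero : (0 : U.AdmissibleSpace α h).toFn = 0 := rfl

lemma tendsto (u : U.AdmissibleSpace α h) :
    Tendsto (fun t => U.varphi α t u.toFn) atTop (𝓝 0) := (Subtype.prop u).1

lemma apply_zero (u : U.AdmissibleSpace α h) : u.toFn 0 = 0 :=
  norm_le_zero_iff.1 ((norm_le_varphi h 0 u.toFn).trans (Subtype.prop u).2.le)

/-- The norm `‖u‖_{U,α} = sup_{t ≥ 0} φ_{U,α}(t,u)`. -/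
instance : Norm (U.AdmissibleSpace α h) := ⟨fun u => ⨆ t : ℝ≥0, U.varphi α t u.toFn⟩

lemma norm_def (u : U.AdmissibleSpace α h) : ‖u‖ = ⨆ t : ℝ≥0, U.varphi α t u.toFn := rfl

lemma bddAbove (u : U.AdmissibleSpace α h) :
    BddAbove (Set.range fun t : ℝ≥0 => U.varphi α t u.toFn) := by
  obtain ⟨M, hMc, -, hM⟩ := id h
  obtain ⟨a, ha⟩ := eventually_atTop.1 (u.tendsto.eventually (gt_mem_nhds zero_lt_one))
  obtain ⟨C, hC⟩ := (isCompact_Icc (a := (0 : ℝ≥0)) (b := a)).bddAbove_image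
    (f := fun t => M t * ‖u.toFn t‖)
    (hMc.mul (continuous_norm.comp u.toFn.continuous)).continuousOn
  refine ⟨max C 1, ?_⟩
  rintro _ ⟨t, rfl⟩
  rcases le_total t a with hta | hta
  · exact (varphi_le hM t u.toFn).trans
      ((hC (Set.mem_image_of_mem _ ⟨zero_le, hta⟩)).trans (le_max_left _ _))
  · exact (ha t hta).le.trans (le_max_right _ _)

lemma varphi_le_norm (u : U.AdmissibleSpace α h) (t : ℝ≥0) : U.varphi α t u.toFn ≤ ‖u‖ :=
  le_ciSup u.bddAbove t

lemma core : NormedSpace.Core ℂ (U.AdmissibleSpace α h) where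
  norm_nonneg u := Real.iSup_nonneg fun t => varphi_nonneg t _
  norm_smul c u := by
    simp only [norm_def, toFn_smul, varphi_smul]
    rw [Real.mul_iSup_of_nonneg (norm_nonneg c)]
  norm_triangle u v := ciSup_le fun t => by
    rw [toFn_add]
    exact (varphi_add_le h t _ _).trans (add_le_add (varphi_le_norm u t) (varphi_le_norm v t))
  norm_eq_zero_iff u := by
    constructor
    · intro hu
      ext s
      exact norm_le_zero_iff.1
        ((norm_le_varphi h s u.toFn).trans ((varphi_le_norm u s).trans hu.le))
    · rintro rfl
      have h0 : ∀ t, U.varphi α t (0 : C(ℝ≥0, X)) = 0 := fun t => varphi_eq_zero t 0 rfl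
      simp [norm_def, h0]

instance : NormedAddCommGroup (U.AdmissibleSpace α h) := NormedAddCommGroup.ofCore core

instance : NormedSpace ℂ (U.AdmissibleSpace α h) := NormedSpace.ofCore core

end AdmissibleSpace

/-! ### The nonuniform evolution semigroup -/

lemma continuous_shift (h : U.IsAdmissible α) (t : ℝ≥0) (u : C(ℝ≥0, X)) :
    Continuous fun s : ℝ≥0 => U.op s (s - t) (u (s - t)) := by
  obtain ⟨M, hMc, -, hM⟩ := h
  have hsub : Continuous fun s : ℝ≥0 => s - t := by fun_prop
  have hcoe : Continuous fun s : ℝ≥0 => ((s - t : ℝ≥0) : ℝ) := by fun_prop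
  rw [continuous_iff_continuousAt]
  intro s₀
  set x₀ := u (s₀ - t) with hx₀
  have hA : Tendsto (fun s : ℝ≥0 => U.op s (s - t) x₀) (𝓝 s₀) (𝓝 (U.op s₀ (s₀ - t) x₀)) := by
    have h1 := U.continuousOn_op x₀
    have h2 : Continuous fun s : ℝ≥0 => U.op s (s - t) x₀ :=
      h1.comp_continuous (continuous_id.prodMk hsub) (fun s => (tsub_le_self : s - t ≤ s))
    exact h2.tendsto s₀
  have hB : Tendsto (fun s : ℝ≥0 => U.op s (s - t) (u (s - t) - x₀)) (𝓝 s₀) (𝓝 0) := by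
    have hb : Continuous fun s : ℝ≥0 => M (s - t) * Real.exp (α * ((s : ℝ) - (s - t : ℝ≥0))) *
        ‖u (s - t) - x₀‖ := by
      refine ((hMc.comp hsub).mul (Real.continuous_exp.comp ?_)).mul ?_
      · exact continuous_const.mul (NNReal.continuous_coe.sub hcoe)
      · exact ((u.continuous.comp hsub).sub continuous_const).norm
    have hb0 := hb.tendsto s₀
    simp only [← hx₀, sub_self, norm_zero, mul_zero] at hb0
    refine squeeze_zero_norm (fun s => ?_) hb0
    exact ((U.op s (s - t)).le_opNorm _).trans
      (mul_le_mul_of_nonneg_right (hM _ _ tsub_le_self) (norm_nonneg _))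
  have hsum := hB.add hA
  simp only [map_sub, sub_add_cancel, zero_add] at hsum
  exact hsum

/-- The function `T_α(t)u`, equal to `U(s,s-t)u(s-t)` for `s > t` and to `0` for `0 ≤ s ≤ t`. -/
def shiftFn (U : EvolutionFamily X) (t : ℝ≥0) (u : ℝ≥0 → X) (s : ℝ≥0) : X :=
  if t < s then U.op s (s - t) (u (s - t)) else 0

lemma continuous_shiftFn (t : ℝ≥0) (u : U.AdmissibleSpace α h) :
    Continuous (U.shiftFn t u.toFn) := by
  convert continuous_shift h t u.toFn using 1
  ext s
  unfold shiftFn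
  split_ifs with hs
  · rfl
  · rw [tsub_eq_zero_of_le (not_lt.1 hs), u.apply_zero, map_zero]

lemma varphi_shiftFn_le (h : U.IsAdmissible α) (t : ℝ≥0) (u : C(ℝ≥0, X))
    (hc : Continuous (U.shiftFn t u)) (s : ℝ≥0) :
    U.varphi α s ⟨U.shiftFn t u, hc⟩ ≤ Real.exp (α * t) * U.varphi α (s - t) u := by
  by_cases hs : t < s
  · refine ciSup_le fun τ => ?_
    have hτ : s ≤ (τ : ℝ≥0) := τ.2
    have h1 := le_ciSup (bddAbove_terms h (s - t) (u (s - t))) ⟨τ, tsub_le_self.trans hτ⟩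
    have h2 : U.op τ s (U.shiftFn t u s) = U.op τ (s - t) (u (s - t)) := by
      rw [shiftFn, if_pos hs, ← U.op_comp τ s (s - t) tsub_le_self hτ]
      rfl
    have h3 : Real.exp (-α * ((τ : ℝ≥0) - (s : ℝ))) =
        Real.exp (α * t) * Real.exp (-α * ((τ : ℝ≥0) - ((s - t : ℝ≥0) : ℝ))) := by
      rw [← Real.exp_add, NNReal.coe_sub hs.le]
      ring_nf
    rw [ContinuousMap.coe_mk, h2, h3, mul_assoc]
    exact mul_le_mul_of_nonneg_left h1 (Real.exp_pos _).le
  · rw [varphi_eq_zero _ _ (by simp [shiftFn, hs])]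
    exact mul_nonneg (Real.exp_pos _).le (varphi_nonneg _ _)

lemma shiftFn_mem (t : ℝ≥0) (u : U.AdmissibleSpace α h) :
    (⟨U.shiftFn t u.toFn, continuous_shiftFn t u⟩ : C(ℝ≥0, X)) ∈ U.admissibleSubmodule α h := by
  refine ⟨squeeze_zero (fun s => varphi_nonneg s _)
    (fun s => varphi_shiftFn_le h t u.toFn (continuous_shiftFn t u) s) ?_,
    varphi_eq_zero _ _ (by simp [shiftFn])⟩
  have hsub : Tendsto (fun s : ℝ≥0 => s - t) atTop atTop :=
    tendsto_atTop.2 fun b => (eventually_ge_atTop (b + t)).mono fun _ hs => le_tsub_of_add_le_right hs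
  have := (u.tendsto.comp hsub).const_mul (Real.exp (α * t))
  simpa using this

/-- The operator `T_α(t)` of the nonuniform evolution semigroup, a bounded linear operator on
`𝒞(U,α)`. -/
def evolutionSemigroup (U : EvolutionFamily X) (α : ℝ) (h : U.IsAdmissible α) (t : ℝ≥0) :
    U.AdmissibleSpace α h →L[ℂ] U.AdmissibleSpace α h :=
  LinearMap.mkContinuous
    { toFun := fun u => ⟨⟨U.shiftFn t u.toFn, continuous_shiftFn t u⟩, shiftFn_mem t u⟩
      map_add' := fun u v => by
        ext s
        change U.shiftFn t (u + v).toFn s = U.shiftFn t u.toFn s + U.shiftFn t v.toFn s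
        unfold shiftFn
        split_ifs <;> simp
      map_smul' := fun c u => by
        ext s
        change U.shiftFn t (c • u).toFn s = c • U.shiftFn t u.toFn s
        unfold shiftFn
        split_ifs <;> simp }
    (Real.exp (α * t))
    (fun u => ciSup_le fun s =>
      (varphi_shiftFn_le h t u.toFn (continuous_shiftFn t u) s).trans
        (mul_le_mul_of_nonneg_left (u.varphi_le_norm _) (Real.exp_pos _).le))

lemma evolutionSemigroup_apply (t : ℝ≥0) (u : U.AdmissibleSpace α h) (s : ℝ≥0) :
    (U.evolutionSemigroup α h t u).toFn s =
      if t < s then U.op s (s - t) (u.toFn (s - t)) else 0 := rfl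

end EvolutionFamily

/-! ### Generators and spectra of unbounded operators -/

section Generator

variable {E : Type*} [NormedAddCommGroup E] [NormedSpace ℂ E]

/-- `x ∈ D(G)` and `G x = y`, i.e. `y = lim_{t → 0+} (T(t)x - x)/t`. -/
def IsGeneratorValue (T : ℝ≥0 → E →L[ℂ] E) (x y : E) : Prop :=
  Tendsto (fun t : ℝ≥0 => ((t : ℝ) : ℂ)⁻¹ • (T t x - x)) (𝓝[>] 0) (𝓝 y)

lemma IsGeneratorValue.unique {T : ℝ≥0 → E →L[ℂ] E} {x y z : E}
    (hy : IsGeneratorValue T x y) (hz : IsGeneratorValue T x z) : y = z :=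
  tendsto_nhds_unique hy hz

lemma IsGeneratorValue.add {T : ℝ≥0 → E →L[ℂ] E} {x x' y y' : E}
    (hy : IsGeneratorValue T x y) (hy' : IsGeneratorValue T x' y') :
    IsGeneratorValue T (x + x') (y + y') := by
  refine (Tendsto.add hy hy').congr fun t => ?_
  rw [map_add, ← smul_add]
  congr 1
  abel

lemma IsGeneratorValue.smul {T : ℝ≥0 → E →L[ℂ] E} {x y : E} (c : ℂ)
    (hy : IsGeneratorValue T x y) : IsGeneratorValue T (c • x) (c • y) := by
  refine (Tendsto.const_smul hy c).congr fun t => ?_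
  rw [map_smul, ← smul_sub, smul_comm]

/-- The (infinitesimal) generator `G` of `T`: its domain consists of the `x` for which
`lim_{t → 0+} (T(t)x - x)/t` exists, and `G x` is this limit. -/
def semigroupGenerator (T : ℝ≥0 → E →L[ℂ] E) : E →ₗ.[ℂ] E where
  domain :=
    { carrier := {x | ∃ y, IsGeneratorValue T x y}
      zero_mem' := ⟨0, by simp [IsGeneratorValue]⟩
      add_mem' := fun ⟨y, hy⟩ ⟨z, hz⟩ => ⟨y + z, hy.add hz⟩
      smul_mem' := fun c _ ⟨y, hy⟩ => ⟨c • y, hy.smul c⟩ }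
  toFun :=
    { toFun := fun x => x.2.choose
      map_add' := fun x x' =>
        (x + x').2.choose_spec.unique (x.2.choose_spec.add x'.2.choose_spec)
      map_smul' := fun c x => (c • x).2.choose_spec.unique (x.2.choose_spec.smul c) }

/-- `lam` is in the resolvent set of the unbounded operator `G`: the map `lam - G : D(G) → E` has a
bounded two-sided inverse `R`. -/
def InResolventSet (G : E →ₗ.[ℂ] E) (lam : ℂ) : Prop :=
  ∃ R : E →L[ℂ] E,
    (∀ y : E, ∃ hy : R y ∈ G.domain, lam • R y - G ⟨R y, hy⟩ = y) ∧
    ∀ x : G.domain, R (lam • (x : E) - G x) = x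

/-- The spectrum of an unbounded operator. -/
def unboundedSpectrum (G : E →ₗ.[ℂ] E) : Set ℂ := {lam | ¬ InResolventSet G lam}

end Generator

end

/-!
The proof compares, for `t > 0`, the spectrum of `T(t) = T_α(t)` with that of the generator `G` and
rests on two facts.

* Spectral inclusion, valid for every strongly continuous semigroup: if `e^{t lam} ∉ σ(T(t))`, then
  `lam ∈ ρ(G)`, with resolvent `∫₀ᵗ e^{-lam r} T(r) dr ∘ (1 - e^{-lam t} T(t))⁻¹`
  (`inResolventSet_of_exp_notMem_spectrum`).
* A strong converse: if `lam ∈ ρ(G)`, then the spectral radius of `T(t)` is less than `|e^{t lam}|`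
  (`EvolutionFamily.norm_lt_of_mem_spectrum`).

For the second fact, measure `x ∈ X` at time `t` by `sup_{τ ≥ t} e^{-α(τ-t)} ‖U(τ,t)x‖`. In these
norms `U` grows uniformly in the initial time, and the norm of `𝒞(U,α)` is their supremum. Let
`v(τ) = e^{-lam (τ-s)} U(τ,s)x` and let `φ ≥ 0` be a bump supported on `[s, s + l]`. As functions in
`𝒞(U,α)` vanish at `0`, the solution of `(lam - G) w = φ v` is `w(t) = (∫ₛᵗ φ) v(t)`
(`EvolutionFamily.apply_eq_integral_smul_trajectory`). With `φ` a parabolic arc, `∫ φ ≥ l³/6` and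
`φ ≤ l²`, so a bound `C` for `v` on `[s, s + l]` yields the bound `6 ‖(lam - G)⁻¹‖ C / l` for `v`
afterwards. Taking `l = 1` shows that `v` is bounded, and taking `l = t - s` then shows that it
decays like `1/(t - s)`, uniformly in `s`; hence `‖T(t)‖ ≤ (K/t) e^{t Re lam}`.

Together the facts give `lam ∈ σ(G) ↔ e^{t lam} ∈ σ(T(t))`, and that with any point of `σ(T(t))` all
nonzero points of no larger modulus belong to `σ(T(t))`. Since `T(t)` is not surjective, `0` belongs
to it too, so it is a disc, and `σ(G)`, the preimage of the disc `σ(T(1))` under `exp`, is a left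
half-plane or empty.
-/

noncomputable section

/-! ### Strongly continuous semigroups -/

section Semigroup

variable {E : Type*} [NormedAddCommGroup E] [NormedSpace ℂ E]

/-- A strongly continuous one-parameter semigroup of bounded linear operators. -/
structure IsStronglyContinuousSemigroup (T : ℝ≥0 → E →L[ℂ] E) : Prop where
  map_zero : T 0 = 1
  map_add : ∀ s t, T (s + t) = T s * T t
  continuous_orbit : ∀ x, Continuous fun t => T t x

namespace IsStronglyContinuousSemigroup

lemma map_pow {T : ℝ≥0 → E →L[ℂ] E} (hT : IsStronglyContinuousSemigroup T) (t : ℝ≥0) (n : ℕ) :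
    T t ^ n = T (n * t) := by
  induction n with
  | zero => simp [hT.map_zero]
  | succ n ih => rw [pow_succ, ih, ← hT.map_add]; congr 1; push_cast; ring

lemma commute {T : ℝ≥0 → E →L[ℂ] E} (hT : IsStronglyContinuousSemigroup T) (s t : ℝ≥0) :
    Commute (T s) (T t) := by
  rw [commute_iff_eq, ← hT.map_add, ← hT.map_add, add_comm]

end IsStronglyContinuousSemigroup

lemma tendsto_toNNReal_nhdsGT_zero : Tendsto Real.toNNReal (𝓝[>] 0) (𝓝[>] 0) := by
  refine tendsto_nhdsWithin_iff.2 ⟨?_, ?_⟩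
  · have := (continuous_real_toNNReal.tendsto 0).mono_left (nhdsWithin_le_nhds (s := Set.Ioi 0))
    simpa using this
  · filter_upwards [self_mem_nhdsWithin] with r hr
    simpa using hr

lemma tendsto_coe_nhdsGT_zero :
    Tendsto (fun t : ℝ≥0 => (t : ℝ)) (𝓝[>] 0) (𝓝[>] 0) := by
  refine tendsto_nhdsWithin_iff.2 ⟨?_, ?_⟩
  · exact (NNReal.continuous_coe.tendsto 0).mono_left nhdsWithin_le_nhds
  · filter_upwards [self_mem_nhdsWithin] with r hr
    simpa using hr

/-- `y = G x` means that `y` is the right derivative at `0` of the orbit of `x`. -/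
lemma isGeneratorValue_iff_hasDerivWithinAt {T : ℝ≥0 → E →L[ℂ] E} (h0 : T 0 = 1) {x y : E} :
    IsGeneratorValue T x y ↔
      HasDerivWithinAt (fun r : ℝ => T r.toNNReal x) y (Set.Ici 0) 0 := by
  rw [← hasDerivWithinAt_Ioi_iff_Ici, hasDerivWithinAt_iff_tendsto_slope' (by simp)]
  constructor
  · intro hy
    refine (hy.comp tendsto_toNNReal_nhdsGT_zero).congr' ?_
    filter_upwards [self_mem_nhdsWithin] with r hr
    have hr' : (0 : ℝ) ≤ r := le_of_lt hr
    simp [slope_def_module, h0, Real.coe_toNNReal r hr', ← Complex.ofReal_inv]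
  · intro hy
    refine (hy.comp tendsto_coe_nhdsGT_zero).congr fun t => ?_
    simp [slope_def_module, h0, ← Complex.ofReal_inv]

/-- The orbit `r ↦ e^{-lam r} T(r) x` of the rescaled semigroup, for real `r`; it is only meant for
`r ≥ 0`, and `T(0)` stands in for the missing operators when `r < 0`. -/
def rescaledOrbit (T : ℝ≥0 → E →L[ℂ] E) (lam : ℂ) (x : E) (r : ℝ) : E :=
  Complex.exp (-(lam * r)) • T r.toNNReal x

lemma hasDerivAt_cexp_neg_mul (lam : ℂ) (r : ℝ) :
    HasDerivAt (fun r : ℝ => Complex.exp (-(lam * r))) (-lam * Complex.exp (-(lam * r))) r := by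
  have h1 : HasDerivAt (fun r : ℝ => -(lam * (r : ℂ))) (-lam) r := by
    simpa using ((Complex.ofRealCLM.hasDerivAt (x := r)).const_mul lam).fun_neg
  simpa [mul_comm] using h1.cexp

variable {T : ℝ≥0 → E →L[ℂ] E}

lemma continuous_rescaledOrbit (hT : IsStronglyContinuousSemigroup T) (lam : ℂ) (x : E) :
    Continuous (rescaledOrbit T lam x) := by
  refine Continuous.smul (by fun_prop) ((hT.continuous_orbit x).comp continuous_real_toNNReal)

/-- If `(lam - G) x = f`, then `e^{-lam r} T(r) x` has the right derivative `-e^{-lam r} T(r) f`. -/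
lemma hasDerivWithinAt_rescaledOrbit (hT : IsStronglyContinuousSemigroup T) {lam : ℂ} {x f : E}
    (hx : IsGeneratorValue T x (lam • x - f)) {r : ℝ} (hr : 0 ≤ r) :
    HasDerivWithinAt (rescaledOrbit T lam x) (-rescaledOrbit T lam f r) (Set.Ici r) r := by
  have h1 := (isGeneratorValue_iff_hasDerivWithinAt hT.map_zero).1 hx
  have h2 : HasDerivWithinAt (fun r' : ℝ => T (r' - r).toNNReal x) (lam • x - f)
      (Set.Ici r) r := by
    have h3 : HasDerivWithinAt (fun r' : ℝ => r' - r) 1 (Set.Ici r) r :=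
      ((hasDerivAt_id r).sub_const r).hasDerivWithinAt
    have h4 := HasDerivWithinAt.scomp_of_eq (h := fun r' : ℝ => r' - r) r h1 h3
      (fun r' (hr' : r ≤ r') => sub_nonneg.2 hr') (sub_self r).symm
    simpa [Function.comp_def] using h4
  have h3 : HasDerivWithinAt (fun r' : ℝ => T r'.toNNReal x) (T r.toNNReal (lam • x - f))
      (Set.Ici r) r := by
    have h4 := ((T r.toNNReal).restrictScalars ℝ).hasFDerivAt.comp_hasDerivWithinAt r h2
    refine h4.congr_of_mem (fun r' (hr' : r ≤ r') => ?_) Set.self_mem_Ici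
    have : r'.toNNReal = r.toNNReal + (r' - r).toNNReal := by
      rw [← Real.toNNReal_add hr (sub_nonneg.2 hr'), add_sub_cancel]
    simp [this, hT.map_add]
  refine ((hasDerivAt_cexp_neg_mul lam r).hasDerivWithinAt.smul h3).congr_deriv ?_
  rw [rescaledOrbit, map_sub, map_smul, smul_sub, smul_smul, neg_mul, neg_smul]
  rw [mul_comm]
  abel

/-- A bounded operator that commutes with the semigroup and is a right inverse of `lam - G` is also
a left inverse. -/
lemma inResolventSet_of_commute {lam : ℂ} (R : E →L[ℂ] E) (hR : ∀ t, Commute R (T t))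
    (hG : ∀ y, IsGeneratorValue T (R y) (lam • R y - y)) :
    InResolventSet (semigroupGenerator T) lam := by
  refine ⟨R, fun y => ⟨⟨_, hG y⟩, ?_⟩, fun x => ?_⟩
  · have hmem : R y ∈ (semigroupGenerator T).domain := ⟨_, hG y⟩
    have : semigroupGenerator T ⟨R y, hmem⟩ = lam • R y - y :=
      hmem.choose_spec.unique (hG y)
    rw [this, sub_sub_cancel]
  · have hx : IsGeneratorValue T (x : E) (semigroupGenerator T x) := x.2.choose_spec
    have h1 : IsGeneratorValue T (R x) (R (semigroupGenerator T x)) := by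
      refine ((R.continuous.tendsto _).comp hx).congr fun t => ?_
      have : R (T t x) = T t (R x) := congrArg (fun A : E →L[ℂ] E => A x) (hR t).eq
      simp [this]
    rw [map_sub, map_smul, h1.unique (hG x), sub_sub_cancel]

/-- The domain condition and the equation for the resolvent, as a generator value. -/
lemma InResolventSet.exists_isGeneratorValue {lam : ℂ}
    (hlam : InResolventSet (semigroupGenerator T) lam) :
    ∃ R : E →L[ℂ] E, ∀ y, IsGeneratorValue T (R y) (lam • R y - y) := by
  obtain ⟨R, hR, -⟩ := hlam
  refine ⟨R, fun y => ?_⟩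
  obtain ⟨hy, hy'⟩ := hR y
  have h1 : IsGeneratorValue T (R y) (semigroupGenerator T ⟨R y, hy⟩) := hy.choose_spec
  rwa [show lam • R y - y = semigroupGenerator T ⟨R y, hy⟩ by nth_rw 2 [← hy']; abel]

variable [CompleteSpace E]

lemma exists_norm_le_on_Icc (hT : IsStronglyContinuousSemigroup T) (t : ℝ≥0) :
    ∃ C, ∀ s ≤ t, ‖T s‖ ≤ C := by
  obtain ⟨C, hC⟩ := banach_steinhaus (g := fun s : Set.Icc 0 t => T s) fun x => by
    obtain ⟨C, hC⟩ := (isCompact_Icc (a := 0) (b := t)).exists_bound_of_continuousOn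
      (hT.continuous_orbit x).continuousOn
    exact ⟨C, fun s => hC s s.2⟩
  exact ⟨C, fun s hs => hC ⟨s, zero_le, hs⟩⟩

lemma exists_norm_rescaledOrbit_le (hT : IsStronglyContinuousSemigroup T) (lam : ℂ) (t : ℝ≥0) :
    ∃ C, ∀ x, ∀ r ∈ Set.Icc (0 : ℝ) t, ‖rescaledOrbit T lam x r‖ ≤ C * ‖x‖ := by
  obtain ⟨C, hC⟩ := exists_norm_le_on_Icc hT t
  obtain ⟨D, hD⟩ := (isCompact_Icc (a := (0 : ℝ)) (b := t)).exists_bound_of_continuousOn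
    (f := fun r : ℝ => Complex.exp (-(lam * r))) (by fun_prop)
  refine ⟨D * C, fun x r hr => ?_⟩
  have hrt : r.toNNReal ≤ t := Real.toNNReal_le_iff_le_coe.2 hr.2
  rw [rescaledOrbit, norm_smul, mul_assoc]
  exact mul_le_mul (hD r hr) (((T _).le_opNorm x).trans
    (mul_le_mul_of_nonneg_right (hC _ hrt) (norm_nonneg x))) (norm_nonneg _)
    ((norm_nonneg _).trans (hD r hr))

/-- The bounded operator `x ↦ ∫₀ᵗ e^{-lam r} T(r) x dr`. -/
def truncatedLaplace (hT : IsStronglyContinuousSemigroup T) (lam : ℂ) (t : ℝ≥0) : E →L[ℂ] E :=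
  LinearMap.mkContinuousOfExistsBound
    { toFun := fun x => ∫ r in (0 : ℝ)..t, rescaledOrbit T lam x r
      map_add' := fun x y => by
        rw [← intervalIntegral.integral_add
          ((continuous_rescaledOrbit hT lam x).intervalIntegrable _ _)
          ((continuous_rescaledOrbit hT lam y).intervalIntegrable _ _)]
        simp [rescaledOrbit]
      map_smul' := fun c x => by
        rw [RingHom.id_apply, ← intervalIntegral.integral_smul]
        simp [rescaledOrbit, smul_comm c] }
    (by
      obtain ⟨C, hC⟩ := exists_norm_rescaledOrbit_le hT lam t
      refine ⟨C * t, fun x => ?_⟩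
      have := intervalIntegral.norm_integral_le_of_norm_le_const (a := 0) (b := (t : ℝ))
        (C := C * ‖x‖) (f := rescaledOrbit T lam x) fun r hr => by
          rw [Set.uIoc_of_le t.coe_nonneg] at hr
          exact hC x r ⟨hr.1.le, hr.2⟩
      rw [sub_zero, abs_of_nonneg t.coe_nonneg] at this
      exact this.trans_eq (by ring))

lemma truncatedLaplace_apply (hT : IsStronglyContinuousSemigroup T) (lam : ℂ) (t : ℝ≥0) (x : E) :
    truncatedLaplace hT lam t x = ∫ r in (0 : ℝ)..t, rescaledOrbit T lam x r := rfl

lemma truncatedLaplace_commute (hT : IsStronglyContinuousSemigroup T) (lam : ℂ) (t : ℝ≥0)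
    (A : E →L[ℂ] E) (hA : ∀ s, Commute A (T s)) : Commute A (truncatedLaplace hT lam t) := by
  ext x
  have h1 := A.intervalIntegral_comp_comm
    ((continuous_rescaledOrbit hT lam x).intervalIntegrable (μ := MeasureTheory.volume) 0 t)
  simp only [mul_apply_eq_comp, truncatedLaplace_apply]
  rw [← h1]
  congr 1
  ext r
  have : A (T r.toNNReal x) = T r.toNNReal (A x) :=
    congrArg (fun A : E →L[ℂ] E => A x) (hA _).eq
  simp [rescaledOrbit, this]

/-- `(lam - G) ∫₀ᵗ e^{-lam r} T(r) x dr = x - e^{-lam t} T(t) x`. -/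
lemma isGeneratorValue_truncatedLaplace (hT : IsStronglyContinuousSemigroup T) (lam : ℂ) (t : ℝ≥0)
    (x : E) :
    IsGeneratorValue T (truncatedLaplace hT lam t x)
      (lam • truncatedLaplace hT lam t x - (x - Complex.exp (-(lam * (t : ℝ))) • T t x)) := by
  rw [isGeneratorValue_iff_hasDerivWithinAt hT.map_zero]
  set F : ℝ → E := fun b => ∫ r in (0 : ℝ)..b, rescaledOrbit T lam x r with hF
  have hc := continuous_rescaledOrbit hT lam x
  have hFd : ∀ b, HasDerivAt F (rescaledOrbit T lam x b) b := fun b =>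
    (hc.integral_hasStrictDerivAt 0 b).hasDerivAt
  have hcongr : ∀ s ∈ Set.Ici (0 : ℝ), T s.toNNReal (truncatedLaplace hT lam t x) =
      Complex.exp (-(-lam * s)) • (F (s + t) - F s) := by
    intro s hs
    have h1 := (T s.toNNReal).intervalIntegral_comp_comm
      (hc.intervalIntegrable (μ := MeasureTheory.volume) 0 t)
    rw [truncatedLaplace_apply, ← h1]
    have h2 : F (s + t) - F s = ∫ r in (0 : ℝ)..t, rescaledOrbit T lam x (r + s) := by
      rw [intervalIntegral.integral_comp_add_right, zero_add, add_comm s]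
      exact intervalIntegral.integral_interval_sub_left (hc.intervalIntegrable _ _)
        (hc.intervalIntegrable _ _)
    rw [h2, ← intervalIntegral.integral_smul]
    refine intervalIntegral.integral_congr fun r hr => ?_
    rw [Set.uIcc_of_le t.coe_nonneg] at hr
    simp only [rescaledOrbit, map_smul]
    rw [Real.toNNReal_add hr.1 hs, add_comm r.toNNReal, hT.map_add, mul_apply_eq_comp, smul_smul,
      ← Complex.exp_add]
    congr 2
    push_cast
    ring
  have hd : HasDerivAt (fun s : ℝ => Complex.exp (-(-lam * s)) • (F (s + t) - F s))
      (lam • truncatedLaplace hT lam t x - (x - Complex.exp (-(lam * (t : ℝ))) • T t x)) 0 := by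
    have h1 : HasDerivAt (fun s : ℝ => F (s + t)) (rescaledOrbit T lam x (0 + t)) 0 :=
      (hFd (0 + t)).comp_add_const 0 (t : ℝ)
    refine ((hasDerivAt_cexp_neg_mul (-lam) 0).smul (h1.sub (hFd 0))).congr_deriv ?_
    have hF0 : F 0 = 0 := intervalIntegral.integral_same
    have hFt : F t = truncatedLaplace hT lam t x := rfl
    simp [rescaledOrbit, hT.map_zero, hF0, hFt]
    abel
  exact hd.hasDerivWithinAt.congr_of_mem hcongr Set.self_mem_Ici

/-- The spectral inclusion `e^{t σ(G)} ⊆ σ(T(t))`. The resolvent of `G` at `lam` is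
`∫₀ᵗ e^{-lam r} T(r) dr ∘ (1 - e^{-lam t} T(t))⁻¹`. -/
lemma inResolventSet_of_exp_notMem_spectrum (hT : IsStronglyContinuousSemigroup T) {lam : ℂ}
    {t : ℝ≥0} (ht : Complex.exp (((t : ℝ) : ℂ) * lam) ∉ spectrum ℂ (T t)) :
    InResolventSet (semigroupGenerator T) lam := by
  rw [spectrum.notMem_iff] at ht
  obtain ⟨V, hV⟩ := ht
  set e := Complex.exp (((t : ℝ) : ℂ) * lam) with he
  have hVT : ∀ s, Commute (V : E →L[ℂ] E) (T s) := fun s => by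
    rw [hV]
    exact Commute.sub_left (Algebra.commutes e (T s)) (hT.commute t s)
  set S : E →L[ℂ] E := e • (↑V⁻¹ : E →L[ℂ] E) with hS
  have hST : ∀ s, Commute S (T s) := fun s => ((hVT s).units_inv_left).smul_left e
  refine inResolventSet_of_commute (truncatedLaplace hT lam t * S) (fun s => ?_) fun y => ?_
  · exact ((truncatedLaplace_commute hT lam t (T s) fun r => hT.commute s r).symm).mul_left (hST s)
  · have h1 := isGeneratorValue_truncatedLaplace hT lam t (S y)
    have h2 : S y - Complex.exp (-(lam * (t : ℝ))) • T t (S y) = y := by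
      have h3 : (V : E →L[ℂ] E) ((↑V⁻¹ : E →L[ℂ] E) y) = y :=
        congrArg (fun A : E →L[ℂ] E => A y) V.mul_inv
      have h4 : Complex.exp (-(lam * (t : ℝ))) * e = 1 := by
        rw [he, ← Complex.exp_add, mul_comm lam, neg_add_cancel, Complex.exp_zero]
      rw [hV] at h3
      simp only [hS, smul_apply, map_smul, smul_smul, h4, one_smul]
      simpa [Algebra.algebraMap_eq_smul_one] using h3
    rwa [h2] at h1

end Semigroup

namespace EvolutionFamily

variable {X : Type*} [NormedAddCommGroup X] [NormedSpace ℂ X] {U : EvolutionFamily X} {α : ℝ}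

/-! ### The weighted norms `x ↦ sup_{τ ≥ t} e^{-α(τ-t)} ‖U(τ,t)x‖` -/

/-- The norm `sup_{τ ≥ t} e^{-α(τ-t)} ‖U(τ,t)x‖` on `X` attached to the time `t`. -/
def weightedNorm (U : EvolutionFamily X) (α : ℝ) (t : ℝ≥0) (x : X) : ℝ :=
  U.varphi α t (.const _ x)

lemma weightedNorm_nonneg (t : ℝ≥0) (x : X) : 0 ≤ U.weightedNorm α t x := varphi_nonneg t _

lemma weightedNorm_smul (t : ℝ≥0) (c : ℂ) (x : X) :
    U.weightedNorm α t (c • x) = ‖c‖ * U.weightedNorm α t x :=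
  varphi_smul t c (.const _ x)

lemma weightedNorm_zero (t : ℝ≥0) : U.weightedNorm α t 0 = 0 := varphi_eq_zero t _ rfl

lemma le_weightedNorm (h : U.IsAdmissible α) {t τ : ℝ≥0} (hτ : t ≤ τ) (x : X) :
    Real.exp (-α * ((τ : ℝ) - t)) * ‖U.op τ t x‖ ≤ U.weightedNorm α t x :=
  le_ciSup (bddAbove_terms h t x) ⟨τ, hτ⟩

lemma weightedNorm_le {t : ℝ≥0} {x : X} {C : ℝ}
    (hC : ∀ τ, t ≤ τ → Real.exp (-α * ((τ : ℝ) - t)) * ‖U.op τ t x‖ ≤ C) :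
    U.weightedNorm α t x ≤ C :=
  ciSup_le fun τ => hC τ τ.2

/-- In the weighted norms the evolution family grows uniformly. -/
lemma weightedNorm_op_le (h : U.IsAdmissible α) {s t : ℝ≥0} (hst : s ≤ t) (x : X) :
    U.weightedNorm α t (U.op t s x) ≤ Real.exp (α * ((t : ℝ) - s)) * U.weightedNorm α s x := by
  refine weightedNorm_le fun τ hτ => ?_
  have h1 : U.op τ t (U.op t s x) = U.op τ s x := by rw [← U.op_comp τ t s hst hτ]; rfl
  have h2 : Real.exp (-α * ((τ : ℝ) - t)) =
      Real.exp (α * ((t : ℝ) - s)) * Real.exp (-α * ((τ : ℝ) - s)) := by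
    rw [← Real.exp_add]; ring_nf
  rw [h1, h2, mul_assoc]
  exact mul_le_mul_of_nonneg_left (le_weightedNorm h (hst.trans hτ) x) (Real.exp_pos _).le

/-- Joint continuity of `(t,s,x) ↦ U(t,s)x`: local uniform boundedness of `U(t,s)` upgrades strong
continuity. -/
lemma continuous_op_apply (h : U.IsAdmissible α) {Y : Type*} [TopologicalSpace Y] {a b : Y → ℝ≥0}
    {v : Y → X} (ha : Continuous a) (hb : Continuous b) (hv : Continuous v)
    (hba : ∀ y, b y ≤ a y) : Continuous fun y => U.op (a y) (b y) (v y) := by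
  obtain ⟨M, hMc, -, hM⟩ := h
  rw [continuous_iff_continuousAt]
  intro y₀
  have hA : Tendsto (fun y => U.op (a y) (b y) (v y₀)) (𝓝 y₀) (𝓝 (U.op (a y₀) (b y₀) (v y₀))) :=
    ((U.continuousOn_op (v y₀)).comp_continuous (ha.prodMk hb) hba).tendsto y₀
  have hB : Tendsto (fun y => U.op (a y) (b y) (v y - v y₀)) (𝓝 y₀) (𝓝 0) := by
    have hc : Continuous fun y => M (b y) * Real.exp (α * ((a y : ℝ) - b y)) * ‖v y - v y₀‖ := by
      fun_prop
    have hc0 := hc.tendsto y₀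
    simp only [sub_self, norm_zero, mul_zero] at hc0
    refine squeeze_zero_norm (fun y => ?_) hc0
    exact ((U.op _ _).le_opNorm _).trans
      (mul_le_mul_of_nonneg_right (hM _ _ (hba y)) (norm_nonneg _))
  have hsum := hB.add hA
  simp only [map_sub, sub_add_cancel, zero_add] at hsum
  exact hsum

/-! ### The space `𝒞(U,α)` -/

namespace AdmissibleSpace

variable {h : U.IsAdmissible α}

lemma weightedNorm_le_norm (u : U.AdmissibleSpace α h) (t : ℝ≥0) :
    U.weightedNorm α t (u.toFn t) ≤ ‖u‖ := varphi_le_norm u t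

lemma norm_apply_le (u : U.AdmissibleSpace α h) (t : ℝ≥0) : ‖u.toFn t‖ ≤ ‖u‖ :=
  (norm_le_varphi h t u.toFn).trans (varphi_le_norm u t)

lemma norm_le {u : U.AdmissibleSpace α h} {C : ℝ}
    (hC : ∀ t, U.weightedNorm α t (u.toFn t) ≤ C) : ‖u‖ ≤ C := ciSup_le hC

lemma toFn_sub (u v : U.AdmissibleSpace α h) : (u - v).toFn = u.toFn - v.toFn := rfl

lemma toFn_neg (u : U.AdmissibleSpace α h) : (-u).toFn = -u.toFn := rfl

/-- Evaluation at a time, a bounded linear operator `𝒞(U,α) → X`. -/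
def eval (t : ℝ≥0) : U.AdmissibleSpace α h →L[ℂ] X :=
  LinearMap.mkContinuous
    { toFun := fun u => u.toFn t
      map_add' := fun _ _ => rfl
      map_smul' := fun _ _ => rfl } 1 fun u => (norm_apply_le u t).trans_eq (one_mul _).symm

@[simp] lemma eval_apply (t : ℝ≥0) (u : U.AdmissibleSpace α h) : eval t u = u.toFn t := rfl

/-- A continuous function of bounded support that vanishes at `0`, as an element of `𝒞(U,α)`. -/
def ofBoundedSupport (h : U.IsAdmissible α) (v : C(ℝ≥0, X)) (h0 : v 0 = 0) (b : ℝ≥0)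
    (hb : ∀ t, b ≤ t → v t = 0) : U.AdmissibleSpace α h :=
  ⟨v, tendsto_const_nhds.congr' ((eventually_ge_atTop b).mono fun t ht =>
    (varphi_eq_zero t v (hb t ht)).symm), varphi_eq_zero 0 v h0⟩

lemma toFn_ofBoundedSupport (v : C(ℝ≥0, X)) (h0 : v 0 = 0) (b : ℝ≥0)
    (hb : ∀ t, b ≤ t → v t = 0) : (ofBoundedSupport h v h0 b hb).toFn = v := rfl

instance [CompleteSpace X] : CompleteSpace (U.AdmissibleSpace α h) := by
  refine Metric.complete_of_cauchySeq_tendsto fun u hu => ?_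
  -- the pointwise limit is uniform, hence continuous
  have hpt : ∀ t, ∃ x, Tendsto (fun n => (u n).toFn t) atTop (𝓝 x) := fun t =>
    cauchySeq_tendsto_of_complete (hu.map (eval t).uniformContinuous)
  choose w hw using hpt
  have hbound : ∀ ε > 0, ∃ N, ∀ n ≥ N, ∀ t τ : ℝ≥0, t ≤ τ →
      Real.exp (-α * ((τ : ℝ) - t)) * ‖U.op τ t ((u n).toFn t - w t)‖ ≤ ε := by
    intro ε hε
    obtain ⟨N, hN⟩ := Metric.cauchySeq_iff.1 hu ε hε
    refine ⟨N, fun n hn t τ hτ => ?_⟩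
    have hlim : Tendsto (fun m => Real.exp (-α * ((τ : ℝ) - t)) *
        ‖U.op τ t ((u n).toFn t - (u m).toFn t)‖) atTop
        (𝓝 (Real.exp (-α * ((τ : ℝ) - t)) * ‖U.op τ t ((u n).toFn t - w t)‖)) :=
      ((((U.op τ t).continuous.tendsto _).comp ((hw t).const_sub _)).norm).const_mul _
    refine le_of_tendsto hlim ((eventually_ge_atTop N).mono fun m hm => ?_)
    refine (le_weightedNorm h hτ _).trans ((weightedNorm_le_norm (u n - u m) t).trans ?_)
    rw [← dist_eq_norm]
    exact (hN n hn m hm).le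
  have hunif : TendstoUniformly (fun n t => (u n).toFn t) w atTop := by
    rw [Metric.tendstoUniformly_iff]
    intro ε hε
    obtain ⟨N, hN⟩ := hbound (ε / 2) (half_pos hε)
    filter_upwards [eventually_ge_atTop N] with n hn t
    have := hN n hn t t le_rfl
    simp only [sub_self, mul_zero, Real.exp_zero, one_mul, U.op_self,
      ContinuousLinearMap.id_apply] at this
    rw [dist_comm, dist_eq_norm]
    linarith
  have hwc : Continuous w :=
    hunif.continuous (Frequently.of_forall fun n => (u n).toFn.continuous)
  have hw0 : w 0 = 0 := tendsto_nhds_unique (hw 0) (by simp [apply_zero])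
  have hsub : ∀ ε > 0, ∃ N, ∀ n ≥ N, ∀ t, U.varphi α t ((u n).toFn - ⟨w, hwc⟩) ≤ ε := by
    intro ε hε
    obtain ⟨N, hN⟩ := hbound ε hε
    exact ⟨N, fun n hn t => ciSup_le fun τ => hN n hn t τ τ.2⟩
  have hmem : (⟨w, hwc⟩ : C(ℝ≥0, X)) ∈ U.admissibleSubmodule α h := by
    refine ⟨?_, varphi_eq_zero 0 _ hw0⟩
    rw [Metric.tendsto_atTop]
    intro ε hε
    obtain ⟨N, hN⟩ := hsub (ε / 2) (half_pos hε)
    obtain ⟨a, ha⟩ := eventually_atTop.1 ((u N).tendsto.eventually (gt_mem_nhds (half_pos hε)))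
    refine ⟨a, fun t ht => ?_⟩
    have h1 : (⟨w, hwc⟩ : C(ℝ≥0, X)) = (u N).toFn + (-1 : ℂ) • ((u N).toFn - ⟨w, hwc⟩) := by
      ext; simp
    have h2 := varphi_add_le h t (u N).toFn ((-1 : ℂ) • ((u N).toFn - ⟨w, hwc⟩))
    rw [← h1, varphi_smul, norm_neg, norm_one, one_mul] at h2
    rw [Real.dist_0_eq_abs, abs_of_nonneg (varphi_nonneg _ _)]
    linarith [ha t ht, hN N le_rfl t]
  let W : U.AdmissibleSpace α h := ⟨⟨w, hwc⟩, hmem⟩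
  refine ⟨W, Metric.tendsto_atTop.2 fun ε hε => ?_⟩
  obtain ⟨N, hN⟩ := hsub (ε / 2) (half_pos hε)
  refine ⟨N, fun n hn => ?_⟩
  rw [dist_eq_norm]
  exact (norm_le fun t => hN n hn t).trans_lt (half_lt_self hε)

end AdmissibleSpace

/-! ### Strong continuity of the evolution semigroup -/

variable {h : U.IsAdmissible α}

open AdmissibleSpace

/-- The formula for `T_α(t)u` without case distinction; truncated subtraction takes care of
`s ≤ t`, because `u(0) = 0`. -/
lemma evolutionSemigroup_apply_eq (t : ℝ≥0) (u : U.AdmissibleSpace α h) (s : ℝ≥0) :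
    (U.evolutionSemigroup α h t u).toFn s = U.op s (s - t) (u.toFn (s - t)) := by
  rw [evolutionSemigroup_apply]
  split_ifs with hs
  · rfl
  · rw [tsub_eq_zero_of_le (not_lt.1 hs), u.apply_zero, map_zero]

lemma norm_evolutionSemigroup_le (t : ℝ≥0) : ‖U.evolutionSemigroup α h t‖ ≤ Real.exp (α * t) :=
  LinearMap.mkContinuous_norm_le _ (Real.exp_pos _).le _

lemma evolutionSemigroup_zero : U.evolutionSemigroup α h 0 = 1 := by
  ext u s
  simp [evolutionSemigroup_apply_eq, U.op_self]

lemma evolutionSemigroup_add (s t : ℝ≥0) :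
    U.evolutionSemigroup α h (s + t) = U.evolutionSemigroup α h s * U.evolutionSemigroup α h t := by
  ext u r
  rw [mul_apply_eq_comp]
  simp only [evolutionSemigroup_apply_eq]
  rw [tsub_add_eq_tsub_tsub, ← U.op_comp r (r - s) (r - s - t) tsub_le_self tsub_le_self]
  rfl

lemma tendsto_evolutionSemigroup_zero (u : U.AdmissibleSpace α h) :
    Tendsto (fun t => U.evolutionSemigroup α h t u) (𝓝 0) (𝓝 u) := by
  obtain ⟨M, hMc, hM0, hM⟩ := id h
  rw [Metric.tendsto_nhds]
  intro ε hε
  set δ := ε / (2 * (Real.exp |α| + 1)) with hδ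
  have hδ0 : 0 < δ := by positivity
  obtain ⟨a, ha⟩ := eventually_atTop.1 (u.tendsto.eventually (gt_mem_nhds hδ0))
  -- on `[0, a + 1]` joint continuity and compactness give uniform smallness
  have hcpt : ∀ᶠ t in 𝓝 (0 : ℝ≥0), ∀ s ∈ Set.Icc 0 (a + 1),
      M s * ‖U.op s (s - t) (u.toFn (s - t)) - u.toFn s‖ < ε / 2 := by
    refine isCompact_Icc.eventually_forall_of_forall_eventually fun s _ => ?_
    have hc : Continuous fun z : ℝ≥0 × ℝ≥0 =>
        M z.2 * ‖U.op z.2 (z.2 - z.1) (u.toFn (z.2 - z.1)) - u.toFn z.2‖ := by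
      have := continuous_op_apply h (a := fun z : ℝ≥0 × ℝ≥0 => z.2)
        (b := fun z => z.2 - z.1) (v := fun z => u.toFn (z.2 - z.1)) (by fun_prop) (by fun_prop)
        (by fun_prop) fun _ => tsub_le_self
      fun_prop
    have h1 := hc.tendsto (0, s)
    simp only [tsub_zero, U.op_self, ContinuousLinearMap.id_apply, sub_self, norm_zero,
      mul_zero] at h1
    exact h1.eventually (gt_mem_nhds (half_pos hε))
  filter_upwards [hcpt, ge_mem_nhds (zero_lt_one' ℝ≥0)] with t ht ht1
  rw [dist_eq_norm]
  refine (norm_le (C := ε / 2) fun s => ?_).trans_lt (half_lt_self hε)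
  rcases le_total s (a + 1) with hs | hs
  · refine (varphi_le hM s (U.evolutionSemigroup α h t u - u).toFn).trans ?_
    rw [toFn_sub, ContinuousMap.sub_apply, evolutionSemigroup_apply_eq]
    exact (ht s ⟨zero_le, hs⟩).le
  -- beyond `a + 1` both `u` and its translate are small
  · have h1 := varphi_add_le h s (U.evolutionSemigroup α h t u).toFn ((-1 : ℂ) • u.toFn)
    rw [varphi_smul, norm_neg, norm_one, one_mul] at h1
    have h2 : U.varphi α s (U.evolutionSemigroup α h t u).toFn ≤
        Real.exp (α * t) * U.varphi α (s - t) u.toFn :=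
      varphi_shiftFn_le h t u.toFn (continuous_shiftFn t u) s
    have h3 : Real.exp (α * t) ≤ Real.exp |α| := Real.exp_le_exp.2 <|
      (mul_le_mul_of_nonneg_right (le_abs_self α) t.coe_nonneg).trans
        (mul_le_of_le_one_right (abs_nonneg α) ht1)
    have hst : a ≤ s - t := le_tsub_of_add_le_right ((add_le_add le_rfl ht1).trans hs)
    have h4 : Real.exp (α * t) * U.varphi α (s - t) u.toFn ≤ Real.exp |α| * δ :=
      mul_le_mul h3 (ha _ hst).le (varphi_nonneg _ _) (Real.exp_pos _).le
    have h5 := ha s (le_self_add.trans hs)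
    have h6 : Real.exp |α| * δ + δ = ε / 2 := by rw [hδ]; field_simp
    have h7 : (U.evolutionSemigroup α h t u - u).toFn =
        (U.evolutionSemigroup α h t u).toFn + (-1 : ℂ) • u.toFn := by
      rw [toFn_sub]; ext; simp [sub_eq_add_neg]
    change U.varphi α s (U.evolutionSemigroup α h t u - u).toFn ≤ ε / 2
    rw [h7]
    linarith

lemma isStronglyContinuousSemigroup_evolutionSemigroup (U : EvolutionFamily X) (α : ℝ)
    (h : U.IsAdmissible α) : IsStronglyContinuousSemigroup (U.evolutionSemigroup α h) where
  map_zero := evolutionSemigroup_zero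
  map_add := evolutionSemigroup_add
  continuous_orbit u := by
    have hbd : ∀ s t : ℝ≥0, dist (U.evolutionSemigroup α h s u) (U.evolutionSemigroup α h t u) ≤
        Real.exp (|α| * max (s : ℝ) t) * ‖U.evolutionSemigroup α h (nndist s t) u - u‖ := by
      intro s t
      wlog hst : s ≤ t generalizing s t
      · have := this t s (le_of_not_ge hst)
        rwa [dist_comm, nndist_comm, max_comm] at this
      have h1 : t = s + nndist s t := by
        apply NNReal.coe_injective
        have : (s : ℝ) ≤ t := hst
        rw [NNReal.coe_add, coe_nndist, NNReal.dist_eq, abs_sub_comm, abs_of_nonneg] <;> linarith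
      have h2 : U.evolutionSemigroup α h t u - U.evolutionSemigroup α h s u =
          U.evolutionSemigroup α h s (U.evolutionSemigroup α h (nndist s t) u - u) := by
        nth_rw 1 [h1]
        rw [evolutionSemigroup_add, map_sub]; rfl
      rw [dist_comm, dist_eq_norm, h2]
      refine ((U.evolutionSemigroup α h s).le_opNorm _).trans
        (mul_le_mul_of_nonneg_right ((norm_evolutionSemigroup_le s).trans ?_) (norm_nonneg _))
      exact Real.exp_le_exp.2 (mul_le_mul (le_abs_self α) (le_max_left _ _) s.coe_nonneg
        (abs_nonneg α))
    rw [continuous_iff_continuousAt]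
    intro t
    rw [ContinuousAt, tendsto_iff_dist_tendsto_zero]
    refine squeeze_zero (fun _ => dist_nonneg) (fun s => hbd s t) ?_
    have h1 : Tendsto (fun s : ℝ≥0 => nndist s t) (𝓝 t) (𝓝 0) := by
      have : Continuous fun s : ℝ≥0 => nndist s t := by fun_prop
      simpa using this.tendsto t
    have h2 : Tendsto (fun s => ‖U.evolutionSemigroup α h (nndist s t) u - u‖) (𝓝 t) (𝓝 0) :=
      tendsto_iff_norm_sub_tendsto_zero.1 ((tendsto_evolutionSemigroup_zero u).comp h1)
    have h3 : Continuous fun s : ℝ≥0 => Real.exp (|α| * max (s : ℝ) t) := by fun_prop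
    simpa using (h3.tendsto t).mul h2

end EvolutionFamily

namespace EvolutionFamily

variable {X : Type*} [NormedAddCommGroup X] [NormedSpace ℂ X] {U : EvolutionFamily X} {α : ℝ}
  {h : U.IsAdmissible α}

open AdmissibleSpace

/-! ### Test functions along trajectories -/

/-- The parabolic arc `(r - s)(s + l - r)` over `[s, s + l]`, extended by `0`. -/
def parabolicBump (s l r : ℝ) : ℝ := max 0 ((r - s) * (s + l - r))

lemma continuous_parabolicBump (s l : ℝ) : Continuous (parabolicBump s l) := by
  unfold parabolicBump; fun_prop

lemma parabolicBump_nonneg (s l r : ℝ) : 0 ≤ parabolicBump s l r := le_max_left _ _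

lemma parabolicBump_le (s l r : ℝ) : parabolicBump s l r ≤ l ^ 2 :=
  max_le (sq_nonneg l) (by nlinarith [sq_nonneg (2 * (r - s) - l), sq_nonneg l])

lemma parabolicBump_eq_zero_of_le {s l r : ℝ} (hl : 0 ≤ l) (hr : r ≤ s) :
    parabolicBump s l r = 0 :=
  max_eq_left (mul_nonpos_of_nonpos_of_nonneg (by linarith) (by linarith))

lemma parabolicBump_eq_zero_of_ge {s l r : ℝ} (hl : 0 ≤ l) (hr : s + l ≤ r) :
    parabolicBump s l r = 0 :=
  max_eq_left (mul_nonpos_of_nonneg_of_nonpos (by linarith) (by linarith))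

lemma le_integral_parabolicBump {s l t : ℝ} (hl : 0 ≤ l) (ht : s + l ≤ t) :
    l ^ 3 / 6 ≤ ∫ r in s..t, parabolicBump s l r := by
  have hi : ∀ a b, IntervalIntegrable (parabolicBump s l) MeasureTheory.volume a b :=
    fun a b => (continuous_parabolicBump s l).intervalIntegrable a b
  rw [← intervalIntegral.integral_add_adjacent_intervals (hi s (s + l)) (hi (s + l) t)]
  have h1 : 0 ≤ ∫ r in (s + l)..t, parabolicBump s l r :=
    intervalIntegral.integral_nonneg ht fun r _ => parabolicBump_nonneg s l r
  have h2 : ∫ r in s..(s + l), parabolicBump s l r = ∫ r in s..(s + l), (r - s) * (s + l - r) := by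
    refine intervalIntegral.integral_congr fun r hr => ?_
    rw [Set.uIcc_of_le (by linarith)] at hr
    exact max_eq_right (mul_nonneg (by linarith [hr.1]) (by linarith [hr.2]))
  have h3 : ∫ r in s..(s + l), (r - s) * (s + l - r) = l ^ 3 / 6 := by
    rw [intervalIntegral.integral_eq_sub_of_hasDerivAt
      (f := fun r => l * (r - s) ^ 2 / 2 - (r - s) ^ 3 / 3)]
    · ring
    · intro r _
      have hd : HasDerivAt (fun r => r - s) 1 r := (hasDerivAt_id r).sub_const s
      refine ((((hd.pow 2).const_mul l).div_const 2).sub ((hd.pow 3).div_const 3)).congr_deriv ?_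
      norm_num
      ring
    · exact Continuous.intervalIntegrable (by fun_prop) _ _
  linarith

/-- The rescaled trajectory `τ ↦ e^{-lam (τ-s)} U(τ,s)x`. It is only meant for `τ ≥ s`; for
`τ < s` the operator is replaced by `U(s,s)` to keep the function continuous. -/
def trajectory (U : EvolutionFamily X) (lam : ℂ) (s : ℝ≥0) (x : X) (τ : ℝ≥0) : X :=
  Complex.exp (-(lam * ((τ : ℝ) - (s : ℝ) : ℝ))) • U.op (max τ s) s x

lemma continuous_trajectory (h : U.IsAdmissible α) (lam : ℂ) (s : ℝ≥0) (x : X) :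
    Continuous (U.trajectory lam s x) := by
  have := continuous_op_apply h (a := fun τ => max τ s) (b := fun _ => s) (v := fun _ => x)
    (by fun_prop) continuous_const continuous_const fun _ => le_max_right _ _
  unfold trajectory
  fun_prop

lemma op_trajectory (lam : ℂ) {s τ t : ℝ≥0} (hsτ : s ≤ τ) (hτt : τ ≤ t) (x : X) :
    Complex.exp (-(lam * ((t : ℝ) - (τ : ℝ) : ℝ))) • U.op t τ (U.trajectory lam s x τ) =
      U.trajectory lam s x t := by
  rw [trajectory, trajectory, map_smul, smul_smul, ← Complex.exp_add, max_eq_left hsτ,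
    max_eq_left (hsτ.trans hτt), ← U.op_comp t τ s hsτ hτt]
  congr 2
  push_cast
  ring

lemma weightedNorm_trajectory (lam : ℂ) {s t : ℝ≥0} (hst : s ≤ t) (x : X) :
    U.weightedNorm α t (U.trajectory lam s x t) =
      Real.exp (-(lam.re * ((t : ℝ) - s))) * U.weightedNorm α t (U.op t s x) := by
  rw [trajectory, weightedNorm_smul, Complex.norm_exp, max_eq_left hst, Complex.neg_re,
    Complex.re_mul_ofReal]

/-! ### Growth estimates from the resolvent of the generator -/

/-- The variation of constants formula for `(lam - G) w = φ · (trajectory)`: the solution is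
`(∫ φ) · (trajectory)`. It holds because `r ↦ (e^{-lam r} T(r) w)(t)` and
`r ↦ (∫_s^{t-r} φ) · (trajectory)(t)` have the same right derivative and both vanish at `r = t`. -/
lemma apply_eq_integral_smul_trajectory {lam : ℂ} {w f : U.AdmissibleSpace α h}
    (hw : IsGeneratorValue (U.evolutionSemigroup α h) w (lam • w - f)) {φ : ℝ → ℝ}
    (hφ : Continuous φ) {s : ℝ≥0} (hφ0 : ∀ r : ℝ, r ≤ s → φ r = 0) {x : X}
    (hf : ∀ τ : ℝ≥0, f.toFn τ = (φ τ : ℂ) • U.trajectory lam s x τ) (t : ℝ≥0) :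
    w.toFn t = ((∫ r in (s : ℝ)..t, φ r : ℝ) : ℂ) • U.trajectory lam s x t := by
  have hT := isStronglyContinuousSemigroup_evolutionSemigroup U α h
  set T := U.evolutionSemigroup α h with hTdef
  set P := U.trajectory lam s x t with hP
  set Ψ : ℝ → ℝ := fun b => ∫ r in (s : ℝ)..b, φ r with hΨ
  have hΨd : ∀ b, HasDerivAt Ψ (φ b) b := fun b => (hφ.integral_hasStrictDerivAt s b).hasDerivAt
  set k : ℝ → X := fun r => (rescaledOrbit T lam w r).toFn t - Ψ (t - r) • P with hk
  have hkf : ∀ r ∈ Set.Ico (0 : ℝ) t, (rescaledOrbit T lam f r).toFn t = φ (t - r) • P := by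
    intro r hr
    obtain ⟨ρ, rfl⟩ : ∃ ρ : ℝ≥0, (ρ : ℝ) = r := ⟨⟨r, hr.1⟩, rfl⟩
    have hρ : ρ ≤ t := NNReal.coe_le_coe.1 hr.2.le
    rw [rescaledOrbit, toFn_smul, ContinuousMap.smul_apply, Real.toNNReal_coe, hTdef,
      evolutionSemigroup_apply_eq, hf, map_smul, smul_comm, NNReal.coe_sub hρ, Complex.coe_smul]
    rcases le_total s (t - ρ) with hs | hs
    · rw [hP, ← op_trajectory lam hs tsub_le_self, NNReal.coe_sub hρ, sub_sub_cancel]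
    · have : φ ((t : ℝ) - ρ) = 0 := hφ0 _ (by rw [← NNReal.coe_sub hρ]; exact hs)
      rw [this, zero_smul, zero_smul]
  have hconst := constant_of_has_deriv_right_zero (f := k) (a := 0) (b := t) ?_ ?_ t
    (Set.right_mem_Icc.2 t.coe_nonneg)
  · have hΨ0 : Ψ 0 = 0 := by
      rw [hΨ]
      refine (intervalIntegral.integral_congr (g := fun _ => (0 : ℝ)) fun r hr => ?_).trans
        intervalIntegral.integral_zero
      rw [Set.uIcc_of_ge s.coe_nonneg] at hr
      exact hφ0 r hr.2
    have hkt : k t = 0 := by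
      simp [hk, rescaledOrbit, hTdef, evolutionSemigroup_apply_eq, w.apply_zero, hΨ0]
    have hk0 : k 0 = w.toFn t - Ψ t • P := by
      simp [hk, rescaledOrbit, hT.map_zero]
    rw [hkt, hk0] at hconst
    rw [sub_eq_zero.1 hconst.symm, Complex.coe_smul]
  · have h1 : Continuous fun r => (rescaledOrbit T lam w r).toFn t :=
      (eval t).continuous.comp (continuous_rescaledOrbit hT lam w)
    have h2 : Continuous Ψ := continuous_iff_continuousAt.2 fun b => (hΨd b).continuousAt
    exact (h1.sub ((h2.comp (continuous_const.sub continuous_id)).smul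
      continuous_const)).continuousOn
  · intro r hr
    have h1 := ((eval t).restrictScalars ℝ).hasFDerivAt.comp_hasDerivWithinAt r
      (hasDerivWithinAt_rescaledOrbit hT hw hr.1)
    have h2 : HasDerivAt (fun r : ℝ => Ψ (t - r)) (-φ (t - r)) r :=
      (hΨd (t - r)).comp_const_sub (t : ℝ) r
    refine (h1.sub (h2.smul_const P).hasDerivWithinAt).congr_deriv ?_
    simp [toFn_neg, hkf r hr]

/-- Bounded right inverses of `lam - G` turn a bound on a trajectory over an interval of length `l`
into a bound afterwards, smaller by the factor `6‖R‖/l`. -/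
lemma weightedNorm_trajectory_le_of_le {lam : ℂ}
    {R : U.AdmissibleSpace α h →L[ℂ] U.AdmissibleSpace α h}
    (hR : ∀ y, IsGeneratorValue (U.evolutionSemigroup α h) (R y) (lam • R y - y))
    {s l : ℝ≥0} (hl : 0 < l) {x : X} {C : ℝ}
    (hC : ∀ τ, s ≤ τ → τ ≤ s + l → U.weightedNorm α τ (U.trajectory lam s x τ) ≤ C)
    {t : ℝ≥0} (ht : s + l ≤ t) :
    U.weightedNorm α t (U.trajectory lam s x t) ≤ 6 * ‖R‖ * C / l := by
  have hl0 : (0 : ℝ) < l := hl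
  have hC0 : 0 ≤ C := (weightedNorm_nonneg _ _).trans (hC s le_rfl le_self_add)
  set φ := parabolicBump s l with hφ
  have hφle : ∀ r : ℝ, r ≤ s → φ r = 0 := fun r => parabolicBump_eq_zero_of_le hl0.le
  have hφge : ∀ r : ℝ, s + l ≤ r → φ r = 0 := fun r => parabolicBump_eq_zero_of_ge hl0.le
  set f : U.AdmissibleSpace α h := ofBoundedSupport h
    ⟨fun τ => (φ τ : ℂ) • U.trajectory lam s x τ,
      (Complex.continuous_ofReal.comp ((continuous_parabolicBump s l).comp
        NNReal.continuous_coe)).smul (continuous_trajectory h lam s x)⟩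
    (by simp [hφle 0 s.coe_nonneg]) (s + l)
    (fun τ hτ => by
      have : φ τ = 0 := hφge τ (by exact_mod_cast hτ)
      simp [this]) with hf
  have hfτ : ∀ τ : ℝ≥0, f.toFn τ = (φ τ : ℂ) • U.trajectory lam s x τ := fun τ => rfl
  have hfn : ‖f‖ ≤ (l : ℝ) ^ 2 * C := by
    refine norm_le fun τ => ?_
    rw [hfτ, weightedNorm_smul, Complex.norm_real, Real.norm_of_nonneg (parabolicBump_nonneg _ _ _)]
    by_cases hτ : s ≤ τ ∧ τ ≤ s + l
    · exact mul_le_mul (parabolicBump_le _ _ _) (hC τ hτ.1 hτ.2) (weightedNorm_nonneg _ _)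
        (sq_nonneg _)
    · have : parabolicBump s l τ = 0 := by
        rcases not_and_or.1 hτ with h1 | h1
        · exact hφle τ (le_of_not_ge h1)
        · exact hφge τ (by exact_mod_cast le_of_not_ge h1)
      rw [this, zero_mul]
      positivity
  have h1 := weightedNorm_le_norm (R f) t
  rw [apply_eq_integral_smul_trajectory (hR f) (continuous_parabolicBump s l) hφle hfτ t,
    weightedNorm_smul, Complex.norm_real] at h1
  have h2 : (l : ℝ) ^ 3 / 6 ≤ ‖∫ r in (s : ℝ)..t, parabolicBump s l r‖ :=
    (le_integral_parabolicBump hl0.le (by exact_mod_cast ht)).trans (Real.le_norm_self _)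
  have h3 := mul_le_mul_of_nonneg_right h2
    (weightedNorm_nonneg (U := U) (α := α) t (U.trajectory lam s x t))
  have h4 : ‖R f‖ ≤ ‖R‖ * ((l : ℝ) ^ 2 * C) :=
    (R.le_opNorm f).trans (mul_le_mul_of_nonneg_left hfn (norm_nonneg R))
  have h5 := h3.trans (h1.trans h4)
  rw [le_div_iff₀ hl0]
  have h6 : (0 : ℝ) < (l : ℝ) ^ 2 := by positivity
  refine le_of_mul_le_mul_left ?_ h6
  nlinarith [h5]

/-- If `lam ∈ ρ(G)`, then `‖U(t,s)‖` decays relative to `e^{Re lam (t-s)}` in the weighted norms,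
uniformly in `s`. One application of the preceding lemma with `l = 1` makes the rescaled
trajectories bounded, a second one with `l = t - s` makes them decay. -/
lemma exists_weightedNorm_op_le {lam : ℂ}
    (hlam : InResolventSet (semigroupGenerator (U.evolutionSemigroup α h)) lam) :
    ∃ K : ℝ, 0 ≤ K ∧ ∀ s t : ℝ≥0, s < t → ∀ x, U.weightedNorm α t (U.op t s x) ≤
      K / ((t : ℝ) - s) * Real.exp (lam.re * ((t : ℝ) - s)) * U.weightedNorm α s x := by
  obtain ⟨R, hR⟩ := hlam.exists_isGeneratorValue
  set D := Real.exp |α - lam.re| with hD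
  have hD0 : 0 < D := Real.exp_pos _
  have hshort : ∀ s τ : ℝ≥0, s ≤ τ → τ ≤ s + 1 → ∀ x,
      U.weightedNorm α τ (U.trajectory lam s x τ) ≤ D * U.weightedNorm α s x := by
    intro s τ hsτ hτ x
    have h0 : (0 : ℝ) ≤ τ - s := sub_nonneg.2 hsτ
    have h1 : (τ : ℝ) - s ≤ 1 := by
      have : (τ : ℝ) ≤ s + 1 := by exact_mod_cast hτ
      linarith
    rw [weightedNorm_trajectory lam hsτ]
    refine (mul_le_mul_of_nonneg_left (weightedNorm_op_le h hsτ x) (Real.exp_pos _).le).trans ?_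
    rw [← mul_assoc, ← Real.exp_add]
    refine mul_le_mul_of_nonneg_right (Real.exp_le_exp.2 ?_) (weightedNorm_nonneg _ _)
    have h2 : (α - lam.re) * ((τ : ℝ) - s) ≤ |α - lam.re| :=
      (mul_le_mul_of_nonneg_right (le_abs_self _) h0).trans
        (mul_le_of_le_one_right (abs_nonneg _) h1)
    linarith
  have hbdd : ∀ s τ : ℝ≥0, s ≤ τ → ∀ x, U.weightedNorm α τ (U.trajectory lam s x τ) ≤
      (1 + 6 * ‖R‖) * D * U.weightedNorm α s x := by
    intro s τ hsτ x
    have hN := weightedNorm_nonneg (U := U) (α := α) s x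
    have h1 : 0 ≤ D * U.weightedNorm α s x := by positivity
    have h2 : 0 ≤ 6 * ‖R‖ * (D * U.weightedNorm α s x) := by positivity
    rcases le_total τ (s + 1) with hτ | hτ
    · linarith [hshort s τ hsτ hτ x]
    · have h3 := weightedNorm_trajectory_le_of_le hR zero_lt_one
        (fun τ h1 h2 => hshort s τ h1 h2 x) hτ
      rw [NNReal.coe_one, div_one] at h3
      linarith
  refine ⟨6 * ‖R‖ * ((1 + 6 * ‖R‖) * D), by positivity, fun s t hst x => ?_⟩
  have h1 := weightedNorm_trajectory_le_of_le hR (tsub_pos_of_lt hst)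
    (fun τ h1 _ => hbdd s τ h1 x) (add_tsub_cancel_of_le hst.le).le
  rw [weightedNorm_trajectory lam hst.le, NNReal.coe_sub hst.le, Real.exp_neg,
    inv_mul_le_iff₀ (Real.exp_pos _)] at h1
  exact h1.trans_eq (by ring)

lemma exists_norm_evolutionSemigroup_le {lam : ℂ}
    (hlam : InResolventSet (semigroupGenerator (U.evolutionSemigroup α h)) lam) :
    ∃ K : ℝ, 0 ≤ K ∧ ∀ t : ℝ≥0, 0 < t →
      ‖U.evolutionSemigroup α h t‖ ≤ K / t * Real.exp (lam.re * t) := by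
  obtain ⟨K, hK0, hK⟩ := exists_weightedNorm_op_le hlam
  refine ⟨K, hK0, fun t ht => ContinuousLinearMap.opNorm_le_bound _ (by positivity) fun u =>
    norm_le fun s => ?_⟩
  rw [evolutionSemigroup_apply]
  split_ifs with hs
  · have h1 := hK (s - t) s (tsub_lt_self (ht.trans hs) ht) (u.toFn (s - t))
    rw [NNReal.coe_sub hs.le, sub_sub_cancel] at h1
    exact h1.trans (mul_le_mul_of_nonneg_left (weightedNorm_le_norm u _) (by positivity))
  · rw [weightedNorm_zero]
    positivity

/-! ### Spectra -/

lemma exists_apply_ne_zero [Nontrivial X] (h : U.IsAdmissible α) {t : ℝ≥0} (ht : 0 < t) :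
    ∃ u : U.AdmissibleSpace α h, u.toFn t ≠ 0 := by
  obtain ⟨x, hx⟩ := exists_ne (0 : X)
  have h0 : (0 : ℝ) ≤ 2 * t := by positivity
  refine ⟨ofBoundedSupport h ⟨fun τ => (parabolicBump 0 (2 * t) τ : ℂ) • x,
    (Complex.continuous_ofReal.comp ((continuous_parabolicBump 0 (2 * t)).comp
      NNReal.continuous_coe)).smul continuous_const⟩ ?_ (2 * t) fun τ hτ => ?_, ?_⟩
  · simp [parabolicBump_eq_zero_of_le h0 le_rfl]
  · have : parabolicBump 0 (2 * t) τ = 0 :=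
      parabolicBump_eq_zero_of_ge h0 (by rw [zero_add]; exact_mod_cast hτ)
    simp [this]
  · have h1 : (0 : ℝ) < t := ht
    have h2 : parabolicBump 0 (2 * t) t ≠ 0 :=
      (lt_of_lt_of_le (by nlinarith) (le_max_right _ _)).ne'
    simpa [toFn_ofBoundedSupport] using ⟨h2, hx⟩

instance [Nontrivial X] : Nontrivial (U.AdmissibleSpace α h) := by
  obtain ⟨u, hu⟩ := exists_apply_ne_zero h one_pos
  exact ⟨u, 0, fun h0 => hu (by rw [h0]; rfl)⟩

/-- For `t > 0` the operator `T_α(t)` is not surjective, as its values vanish on `[0,t]`. -/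
lemma zero_mem_spectrum_evolutionSemigroup [Nontrivial X] {t : ℝ≥0} (ht : 0 < t) :
    (0 : ℂ) ∈ spectrum ℂ (U.evolutionSemigroup α h t) := by
  rw [spectrum.zero_mem_iff]
  rintro ⟨V, hV⟩
  obtain ⟨u, hu⟩ := exists_apply_ne_zero h ht
  have h1 : (V : _ →L[ℂ] U.AdmissibleSpace α h) ((↑V⁻¹ : _ →L[ℂ] U.AdmissibleSpace α h) u) = u :=
    congrArg (fun A : _ →L[ℂ] U.AdmissibleSpace α h => A u) V.mul_inv
  rw [hV] at h1
  rw [← h1, evolutionSemigroup_apply, if_neg (lt_irrefl t)] at hu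
  exact hu rfl

lemma spectrum_evolutionSemigroup_zero [Nontrivial X] (h : U.IsAdmissible α) :
    spectrum ℂ (U.evolutionSemigroup α h 0) = {1} := by
  rw [evolutionSemigroup_zero, spectrum.one_eq]

variable [CompleteSpace X] [Nontrivial X]

/-- If `lam ∈ ρ(G)`, the spectral radius of `T_α(t)` is less than `|e^{t lam}|`: the powers
`T_α(t)ⁿ = T_α(nt)` have norm less than `e^{nt Re lam}` for large `n`. -/
lemma norm_lt_of_mem_spectrum {lam : ℂ}
    (hlam : InResolventSet (semigroupGenerator (U.evolutionSemigroup α h)) lam) {t : ℝ≥0}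
    (ht : 0 < t) {z : ℂ} (hz : z ∈ spectrum ℂ (U.evolutionSemigroup α h t)) :
    ‖z‖ < Real.exp (t * lam.re) := by
  obtain ⟨K, hK0, hK⟩ := exists_norm_evolutionSemigroup_le hlam
  have ht0 : (0 : ℝ) < t := ht
  obtain ⟨n, hn⟩ := exists_nat_gt (K / t)
  have hn0 : (0 : ℝ) < n := (by positivity : (0 : ℝ) ≤ K / t).trans_lt hn
  have hn1 : K / (n * t : ℝ) < 1 := by
    rw [div_lt_iff₀ ht0] at hn
    rw [div_lt_one (by positivity)]
    exact hn
  have h1 := spectrum.norm_le_norm_of_mem (spectrum.pow_mem_pow _ n hz)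
  rw [(isStronglyContinuousSemigroup_evolutionSemigroup U α h).map_pow, norm_pow] at h1
  have h2 := hK (n * t) (mul_pos (by exact_mod_cast hn0) ht)
  push_cast at h2
  have h3 : Real.exp (lam.re * (n * t)) = Real.exp (t * lam.re) ^ n := by
    rw [← Real.exp_nat_mul]; ring_nf
  rw [h3] at h2
  have h4 : K / (n * t : ℝ) * Real.exp (t * lam.re) ^ n < Real.exp (t * lam.re) ^ n :=
    mul_lt_of_lt_one_left (by positivity) hn1
  exact lt_of_pow_lt_pow_left₀ n (Real.exp_pos _).le ((h1.trans h2).trans_lt h4)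

lemma norm_exp_ofReal_mul (r : ℝ) (lam : ℂ) :
    ‖Complex.exp ((r : ℂ) * lam)‖ = Real.exp (r * lam.re) := by
  rw [Complex.norm_exp, Complex.re_ofReal_mul]

lemma mem_unboundedSpectrum_iff_exp_mem_spectrum {t : ℝ≥0} (ht : 0 < t) (lam : ℂ) :
    lam ∈ unboundedSpectrum (semigroupGenerator (U.evolutionSemigroup α h)) ↔
      Complex.exp (((t : ℝ) : ℂ) * lam) ∈ spectrum ℂ (U.evolutionSemigroup α h t) := by
  constructor
  · intro hlam
    by_contra hz
    exact hlam (inResolventSet_of_exp_notMem_spectrum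
      (isStronglyContinuousSemigroup_evolutionSemigroup U α h) hz)
  · intro hz hlam
    exact (norm_lt_of_mem_spectrum hlam ht hz).ne (norm_exp_ofReal_mul t lam)

lemma exists_exp_ofReal_mul_eq {r : ℝ} (hr : r ≠ 0) {z : ℂ} (hz : z ≠ 0) :
    ∃ lam : ℂ, Complex.exp ((r : ℂ) * lam) = z :=
  ⟨Complex.log z / r, by
    rw [mul_div_cancel₀ _ (Complex.ofReal_ne_zero.2 hr), Complex.exp_log hz]⟩

lemma exists_spectrum_eq_closedBall (h : U.IsAdmissible α) {t : ℝ≥0} (ht : 0 < t) :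
    ∃ r : ℝ, 0 ≤ r ∧ spectrum ℂ (U.evolutionSemigroup α h t) = Metric.closedBall 0 r := by
  obtain ⟨z₀, hz₀, hmax⟩ := (spectrum.isCompact (U.evolutionSemigroup α h t)).exists_isMaxOn
    ⟨0, zero_mem_spectrum_evolutionSemigroup ht⟩ continuous_norm.continuousOn
  refine ⟨‖z₀‖, norm_nonneg _, Set.Subset.antisymm (fun z hz => ?_) fun z hz => ?_⟩
  · rw [mem_closedBall_zero_iff]
    exact hmax hz
  · rw [mem_closedBall_zero_iff] at hz
    rcases eq_or_ne z 0 with rfl | hz0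
    · exact zero_mem_spectrum_evolutionSemigroup ht
    · obtain ⟨lam, rfl⟩ := exists_exp_ofReal_mul_eq (NNReal.coe_ne_zero.2 ht.ne') hz0
      rw [← mem_unboundedSpectrum_iff_exp_mem_spectrum ht]
      intro hlam
      rw [norm_exp_ofReal_mul] at hz
      exact (norm_lt_of_mem_spectrum hlam ht hz₀).not_ge hz

end EvolutionFamily

end

open EvolutionFamily

theorem mainTheorem4 {X : Type*} [NormedAddCommGroup X] [NormedSpace ℂ X] [CompleteSpace X]
    [Nontrivial X] (U : EvolutionFamily X) (α : ℝ) (h : U.IsAdmissible α) :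
    -- the spectral mapping theorem; at `t = 0` it needs a nonempty `σ(G)`
    (∀ t : ℝ≥0, (0 < t ∨ (unboundedSpectrum
        (semigroupGenerator (U.evolutionSemigroup α h))).Nonempty) →
      (fun lam : ℂ => Complex.exp (((t : ℝ) : ℂ) * lam)) ''
          unboundedSpectrum (semigroupGenerator (U.evolutionSemigroup α h)) =
        spectrum ℂ (U.evolutionSemigroup α h t) \ {0}) ∧
    -- `σ(G)` is a closed left half-plane `{Re ≤ ω}`; for `ω = -∞` this is the empty set
    (unboundedSpectrum (semigroupGenerator (U.evolutionSemigroup α h)) = ∅ ∨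
      ∃ ω : ℝ, unboundedSpectrum (semigroupGenerator (U.evolutionSemigroup α h)) =
        {lam : ℂ | lam.re ≤ ω}) ∧
    -- `σ(T(t))` is a closed disc, centred at `0` when `t > 0`, possibly a point
    (∀ t : ℝ≥0, ∃ (c : ℂ) (r : ℝ), 0 ≤ r ∧ (0 < t → c = 0) ∧
      spectrum ℂ (U.evolutionSemigroup α h t) = Metric.closedBall c r) := by
  refine ⟨fun t ht => ?_, ?_, fun t => ?_⟩
  · rcases eq_or_ne t 0 with rfl | ht0
    · have hne := ht.resolve_left (lt_irrefl 0)
      simp [spectrum_evolutionSemigroup_zero, hne.image_const]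
    · have htpos : 0 < t := pos_iff_ne_zero.2 ht0
      ext z
      constructor
      · rintro ⟨lam, hlam, rfl⟩
        exact ⟨(mem_unboundedSpectrum_iff_exp_mem_spectrum htpos lam).1 hlam,
          Complex.exp_ne_zero _⟩
      · rintro ⟨hz, hz0⟩
        obtain ⟨lam, rfl⟩ := exists_exp_ofReal_mul_eq (NNReal.coe_ne_zero.2 ht0) hz0
        exact ⟨lam, (mem_unboundedSpectrum_iff_exp_mem_spectrum htpos lam).2 hz, rfl⟩
  · obtain ⟨r, hr, hball⟩ := exists_spectrum_eq_closedBall h one_pos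
    have hmem : ∀ lam, lam ∈ unboundedSpectrum (semigroupGenerator (U.evolutionSemigroup α h)) ↔
        Real.exp lam.re ≤ r := fun lam => by
      rw [mem_unboundedSpectrum_iff_exp_mem_spectrum one_pos, hball, mem_closedBall_zero_iff,
        norm_exp_ofReal_mul, NNReal.coe_one, one_mul]
    rcases hr.eq_or_lt with rfl | hr0
    · left
      exact Set.eq_empty_of_forall_notMem fun lam hlam =>
        ((hmem lam).1 hlam).not_gt (Real.exp_pos _)
    · right
      exact ⟨Real.log r, Set.ext fun lam => (hmem lam).trans (Real.le_log_iff_exp_le hr0).symm⟩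
  · rcases eq_or_ne t 0 with rfl | ht0
    · exact ⟨1, 0, le_rfl, fun h0 => (lt_irrefl 0 h0).elim, by
        rw [spectrum_evolutionSemigroup_zero, Metric.closedBall_zero]⟩
    · obtain ⟨r, hr, hball⟩ := exists_spectrum_eq_closedBall h (pos_iff_ne_zero.2 ht0)
      exact ⟨0, r, hr, fun _ => rfl, hball⟩
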